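/- Let $\mathbb T$ be the unit circle with normalized Lebesgue measure; functions on $\mathbb T$ that agree almost everywhere are identified. For $p\in\{2,\infty\}$ let $H^p$ be the Hardy space of all $f\in L^p(\mathbb T)$ whose Fourier coefficients $\hat f(k)$ vanish for all $k<0$, and let $\overline{H^\infty}=\{\bar f: f\in H^\infty\}$. A matrix function is said to be in $H^p$ if all its entries are, and $H^2(\mathbb C^m)$ denotes the corresponding space of $\mathbb C^m$-valued functions. An $m\times l$ matrix function $\Phi\in H^\infty$ is *inner* if $\Phi(\zeta)^*\Phi(\zeta)=I_l$ for almost all $\zeta\in\mathbb T$. An $m\times l$ matrix function $F\in H^2$ is *outer* if the linear span of the functions $\zeta\mapsto\zeta^jF(\zeta)x$, $j\ge 0$, $x\in\mathbb C^l$, is dense in $H^2(\mathbb C^m)$; $F$ is *co-outer* if its transpose is outer. Let $0<r<n$. An *$r$-balanced* $n\times n$ matrix function is a unitary-valued matrix function $\mathcal V=(\Upsilon\ \ \overline\Theta)$ on $\mathbb T$, where $\Upsilon$ is an $n\times r$ inner and co-outer matrix function, $\Theta$ is an $n\times(n-r)$ inner and co-outer matrix function, and the bar is entrywise complex conjugation.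 For $r=0$ and for $r=n$, an $r$-balanced $n\times n$ matrix function is a constant unitary matrix. For $i_1<\dots<i_k$ and $j_1<\dots<j_k$ in $\{1,\dots,n\}$ let $\mathcal V_{i_1\cdots i_k,j_1\cdots j_k}$ be the determinant of the submatrix of $\mathcal V$ with rows $i_1,\dots,i_k$ and columns $j_1,\dots,j_k$. It is called a *minor on the first $r$ columns* if $k\ge r$ and $j_1=1,\dots,j_r=r$, and a *minor on the last $n-r$ columns* if $k\ge n-r$ and $j_{k-n+r+1}=r+1,\dots,j_k=n$. **Theorem.** Let $0\le r\le n$, $n\ge1$, and let $\mathcal V$ be an $r$-balanced $n\times n$ matrix function. Then all minors of $\mathcal V$ on the first $r$ columns belong to $H^\infty$, and all minors of $\mathcal V$ on the last $n-r$ columns belong to $\overline{H^\infty}$. Moreover, $\det\mathcal V$ is (almost everywhere equal to) a constant of modulus $1$. -/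

import Mathlib

open MeasureTheory AddCircle
open scoped ENNReal Matrix

noncomputable section

namespace BalancedMatrix

/-- The Hardy space `H^p` on the unit circle, for `1 ≤ p ≤ ∞`: functions in `L^p` whose Fourier
coefficients of negative index vanish. The circle is parametrized by `t ↦ ζ = exp (2πit)`,
`t ∈ ℝ / ℤ`, and carries normalized Lebesgue measure; `fourier k` is the function `ζ ^ k`. -/
def MemHardy (p : ℝ≥0∞) (f : UnitAddCircle → ℂ) : Prop :=
  MemLp f p haarAddCircle ∧ ∀ k : ℤ, k < 0 → fourierCoeff f k = 0

/-- The space of complex conjugates of functions in `H^p`. -/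
def MemConjHardy (p : ℝ≥0∞) (f : UnitAddCircle → ℂ) : Prop :=
  MemHardy p fun ζ => star (f ζ)

/-- Matrix functions all of whose entries are in `H^p`. -/
def MemMatrixHardy {ι κ : Type*} (p : ℝ≥0∞) (F : UnitAddCircle → Matrix ι κ ℂ) : Prop :=
  ∀ i j, MemHardy p fun ζ => F ζ i j

/-- The space `H²(ℂ^ι)` as a subspace of the Hilbert space `L²(ℂ^ι)`. -/
def hardyTwo (ι : Type*) [Fintype ι] :
    Submodule ℂ (Lp (EuclideanSpace ℂ ι) 2 (haarAddCircle : Measure UnitAddCircle)) where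
  carrier := {f | ∀ k : ℤ, k < 0 → fourierCoeff (f : UnitAddCircle → EuclideanSpace ℂ ι) k = 0}
  zero_mem' := by
    intro k _
    rw [fourierCoeff_congr_ae (Lp.coeFn_zero _ _ _)]
    simp [fourierCoeff]
  add_mem' := by
    intro f g hf hg k hk
    rw [fourierCoeff_congr_ae (Lp.coeFn_add f g),
      fourierCoeff.add ((Lp.memLp f).integrable one_le_two) ((Lp.memLp g).integrable one_le_two),
      Pi.add_apply, hf k hk, hg k hk, add_zero]
  smul_mem' := by
    intro c f hf k hk
    rw [fourierCoeff_congr_ae (Lp.coeFn_smul c f), fourierCoeff.const_smul, hf k hk, smul_zero]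

/-- A matrix function `Φ ∈ H^∞` is inner if `Φ(ζ)* Φ(ζ) = I` for almost all `ζ`. -/
def IsInner {ι κ : Type*} [Fintype ι] [DecidableEq κ] (Φ : UnitAddCircle → Matrix ι κ ℂ) : Prop :=
  MemMatrixHardy ∞ Φ ∧ ∀ᵐ ζ ∂haarAddCircle, (Φ ζ)ᴴ * Φ ζ = 1

/-- A matrix function `F ∈ H²` is outer if the linear span of the functions `ζ ↦ ζ ^ j F(ζ) x`,
for `j ≥ 0` and constant vectors `x`, is dense in the vector-valued Hardy space `H²`. -/
def IsOuter {ι κ : Type*} [Fintype ι] [Fintype κ] (F : UnitAddCircle → Matrix ι κ ℂ) : Prop :=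
  MemMatrixHardy 2 F ∧
    (Submodule.span ℂ
      {g : Lp (EuclideanSpace ℂ ι) 2 (haarAddCircle : Measure UnitAddCircle) |
        ∃ (j : ℕ) (x : κ → ℂ), (g : UnitAddCircle → EuclideanSpace ℂ ι) =ᵐ[haarAddCircle]
          fun ζ => WithLp.toLp 2 (fourier (j : ℤ) ζ • (F ζ *ᵥ x))}).topologicalClosure = hardyTwo ι

/-- A matrix function is co-outer if its transpose is outer. -/
def IsCoOuter {ι κ : Type*} [Fintype ι] [Fintype κ] (F : UnitAddCircle → Matrix ι κ ℂ) : Prop :=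
  IsOuter fun ζ => (F ζ)ᵀ

/-- The square matrix `(Υ  Θ̄)`: the first `r` columns are those of `Υ`, the last `n - r` columns
are the entrywise conjugates of those of `Θ`. -/
def conjBlock {n r : ℕ} (Υ : Matrix (Fin n) (Fin r) ℂ) (Θ : Matrix (Fin n) (Fin (n - r)) ℂ) :
    Matrix (Fin n) (Fin n) ℂ :=
  Matrix.of fun i j =>
    if h : (j : ℕ) < r then Υ i ⟨j, h⟩ else star (Θ i ⟨(j : ℕ) - r, by omega⟩)

/-- `r`-balanced `n × n` matrix functions (functions equal almost everywhere are identified). -/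
def IsBalanced {n : ℕ} (r : ℕ) (V : UnitAddCircle → Matrix (Fin n) (Fin n) ℂ) : Prop :=
  (0 < r ∧ r < n ∧
    (∀ᵐ ζ ∂haarAddCircle, V ζ ∈ Matrix.unitaryGroup (Fin n) ℂ) ∧
    ∃ (Υ : UnitAddCircle → Matrix (Fin n) (Fin r) ℂ)
      (Θ : UnitAddCircle → Matrix (Fin n) (Fin (n - r)) ℂ),
      IsInner Υ ∧ IsCoOuter Υ ∧ IsInner Θ ∧ IsCoOuter Θ ∧
      ∀ᵐ ζ ∂haarAddCircle, V ζ = conjBlock (Υ ζ) (Θ ζ)) ∨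
  ((r = 0 ∨ r = n) ∧
    ∃ U ∈ Matrix.unitaryGroup (Fin n) ℂ, ∀ᵐ ζ ∂haarAddCircle, V ζ = U)

/-- The minor of the matrix function `V` with rows `i 0 < i 1 < ⋯` and columns
`j 0 < j 1 < ⋯`. -/
def minor {n k : ℕ} (V : UnitAddCircle → Matrix (Fin n) (Fin n) ℂ) (i j : Fin k ↪o Fin n) :
    UnitAddCircle → ℂ :=
  fun ζ => ((V ζ).submatrix i j).det

/-- The column selection of a minor on the first `r` columns: `k ≥ r` and, counting from `0`,
the `l`-th selected column is column `l` for all `l < r`. -/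
def OnFirstColumns {n k : ℕ} (r : ℕ) (j : Fin k ↪o Fin n) : Prop :=
  r ≤ k ∧ ∀ l : Fin k, (l : ℕ) < r → (j l : ℕ) = l

/-- The column selection of a minor on the last `s` columns: `k ≥ s` and, counting from `0`,
the selected column in position `k - s + t` is column `n - s + t` for all `t < s`. -/
def OnLastColumns {n k : ℕ} (s : ℕ) (j : Fin k ↪o Fin n) : Prop :=
  s ≤ k ∧ ∀ l : Fin k, k ≤ (l : ℕ) + s → (j l : ℕ) + k = l + n

end BalancedMatrix

end

namespace BalancedMatrix

theorem memLp_mul_top {f g : UnitAddCircle → ℂ} (hf : MemLp f ∞ haarAddCircle)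
    (hg : MemLp g ∞ haarAddCircle) : MemLp (fun ζ => f ζ * g ζ) ∞ haarAddCircle :=
  hg.mul (p := ∞) (q := ∞) hf

theorem memLp_prod_top {α : Type*} (s : Finset α) {f : α → UnitAddCircle → ℂ}
    (hf : ∀ a ∈ s, MemLp (f a) ∞ haarAddCircle) :
    MemLp (fun ζ => ∏ a ∈ s, f a ζ) ∞ haarAddCircle := by
  classical
  induction s using Finset.induction_on with
  | empty => simpa using memLp_const (1 : ℂ)
  | insert a s ha ih =>
    simp only [Finset.prod_insert ha]
    exact memLp_mul_top (hf a (Finset.mem_insert_self a s))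
      (ih fun b hb => hf b (Finset.mem_insert_of_mem hb))

theorem memLp_det_top {ι : Type*} [Fintype ι] [DecidableEq ι] {M : UnitAddCircle → Matrix ι ι ℂ}
    (hM : ∀ i j, MemLp (fun ζ => M ζ i j) ∞ haarAddCircle) :
    MemLp (fun ζ => (M ζ).det) ∞ haarAddCircle := by
  simp only [Matrix.det_apply']
  exact memLp_finsetSum _ fun σ _ => (memLp_prod_top _ fun i _ => hM (σ i) i).const_mul _

theorem memLp_two_of_top {f : UnitAddCircle → ℂ} (hf : MemLp f ∞ haarAddCircle) :
    MemLp f 2 haarAddCircle :=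
  hf.mono_exponent le_top

theorem memLp_fourier (m : ℤ) (p : ℝ≥0∞) :
    MemLp (fun ζ : UnitAddCircle => fourier m ζ) p haarAddCircle :=
  MemLp.of_bound (map_continuous (fourier m)).aestronglyMeasurable 1
    (ae_of_all _ fun ζ => by rw [fourier_apply, Circle.norm_coe])

theorem fourierCoeff_const {E : Type*} [NormedAddCommGroup E] [NormedSpace ℂ E] (c : E) {k : ℤ}
    (hk : k ≠ 0) : fourierCoeff (fun _ : UnitAddCircle => c) k = 0 := by
  have h := fourierCoeff_fourier (T := 1) 0
  have h' := congrFun h k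
  by_cases hc : CompleteSpace E
  · rw [fourierCoeff, integral_smul_const]
    simp only [fourierCoeff, fourier_zero, smul_eq_mul, mul_one] at h'
    rw [h', Pi.single_eq_of_ne hk, zero_smul]
  · exact integral_def .. |>.trans (dif_neg hc)

theorem fourierCoeff_star (f : UnitAddCircle → ℂ) (k : ℤ) :
    fourierCoeff (fun ζ => star (f ζ)) k = star (fourierCoeff f (-k)) := by
  simp only [fourierCoeff, neg_neg, smul_eq_mul]
  rw [RCLike.star_def, ← integral_conj]
  simp [fourier_neg, -fourier_apply]

theorem fourierCoeff_fourier_mul (f : UnitAddCircle → ℂ) (m k : ℤ) :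
    fourierCoeff (fun ζ => fourier m ζ * f ζ) k = fourierCoeff f (k - m) := by
  simp only [fourierCoeff, smul_eq_mul, ← mul_assoc, ← fourier_add]
  congr! 4
  ring_nf

/-- Square-integrable functions with vanishing Fourier coefficients of negative index have a
product with the same property. -/
theorem fourierCoeff_mul_eq_zero {f g : UnitAddCircle → ℂ} (hf : MemHardy 2 f)
    (hg : MemHardy 2 g) {k : ℤ} (hk : k < 0) : fourierCoeff (fun ζ => f ζ * g ζ) k = 0 := by
  have hF : MemLp (fun ζ => fourier k ζ * star (f ζ)) 2 haarAddCircle :=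
    hf.1.star.mul (p := ∞) (q := 2) (memLp_fourier k ∞)
  have h := (fourierBasis (T := 1)).tsum_inner_mul_inner (hF.toLp _) (hg.1.toLp _)
  have hz : ∀ i : ℤ, inner ℂ (hF.toLp _) (fourierBasis (T := 1) i) *
      inner ℂ (fourierBasis (T := 1) i) (hg.1.toLp _) = 0 := by
    intro i
    rw [← inner_conj_symm, ← HilbertBasis.repr_apply_apply, ← HilbertBasis.repr_apply_apply,
      fourierBasis_repr, fourierBasis_repr, fourierCoeff_congr_ae hF.coeFn_toLp,
      fourierCoeff_congr_ae hg.1.coeFn_toLp, fourierCoeff_fourier_mul, fourierCoeff_star]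
    rcases lt_or_ge i 0 with hi | hi
    · rw [hg.2 i hi, mul_zero]
    · rw [hf.2 _ (by omega)]
      simp
  rw [tsum_congr hz, tsum_zero, L2.inner_def] at h
  refine Eq.trans ?_ h.symm
  apply integral_congr_ae
  filter_upwards [hF.coeFn_toLp, hg.1.coeFn_toLp] with ζ h1 h2
  rw [h1, h2]
  simp [fourier_neg, -fourier_apply]
  ring

theorem MemHardy.two {f : UnitAddCircle → ℂ} (hf : MemHardy ∞ f) : MemHardy 2 f :=
  ⟨memLp_two_of_top hf.1, hf.2⟩

theorem MemHardy.congr {p : ℝ≥0∞} {f g : UnitAddCircle → ℂ} (hf : MemHardy p f)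
    (h : f =ᵐ[haarAddCircle] g) : MemHardy p g :=
  ⟨(memLp_congr_ae h).1 hf.1, fun k hk => by rw [← fourierCoeff_congr_ae h, hf.2 k hk]⟩

theorem MemHardy.mul {f g : UnitAddCircle → ℂ} (hf : MemHardy ∞ f) (hg : MemHardy ∞ g) :
    MemHardy ∞ fun ζ => f ζ * g ζ :=
  ⟨memLp_mul_top hf.1 hg.1, fun _ hk => fourierCoeff_mul_eq_zero hf.two hg.two hk⟩

theorem MemHardy.const_mul {p : ℝ≥0∞} {f : UnitAddCircle → ℂ} (hf : MemHardy p f) (c : ℂ) :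
    MemHardy p fun ζ => c * f ζ :=
  ⟨hf.1.const_mul c, fun k hk => by rw [fourierCoeff.const_mul, hf.2 k hk, mul_zero]⟩

theorem memHardy_const (p : ℝ≥0∞) (c : ℂ) : MemHardy p fun _ => c :=
  ⟨memLp_const c, fun _ hk => fourierCoeff_const c hk.ne⟩

theorem memHardy_fourier (p : ℝ≥0∞) (j : ℕ) : MemHardy p fun ζ => fourier (j : ℤ) ζ :=
  ⟨memLp_fourier j p, fun k hk => by
    rw [show (fun ζ : UnitAddCircle => fourier (j : ℤ) ζ) = fourier (j : ℤ) from rfl,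
      fourierCoeff_fourier, Pi.single_eq_of_ne (by omega)]⟩

theorem memHardy_sum {α : Type*} (s : Finset α) {f : α → UnitAddCircle → ℂ}
    (hf : ∀ a ∈ s, MemHardy ∞ (f a)) : MemHardy ∞ fun ζ => ∑ a ∈ s, f a ζ := by
  refine ⟨memLp_finsetSum s fun a ha => (hf a ha).1, fun k hk => ?_⟩
  rw [show (fun ζ => ∑ a ∈ s, f a ζ) = ∑ a ∈ s, f a from by ext; simp,
    fourierCoeff.sum s f fun a ha => (hf a ha).1.integrable le_top, Finset.sum_apply]
  exact Finset.sum_eq_zero fun a ha => (hf a ha).2 k hk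

theorem memHardy_prod {α : Type*} (s : Finset α) {f : α → UnitAddCircle → ℂ}
    (hf : ∀ a ∈ s, MemHardy ∞ (f a)) : MemHardy ∞ fun ζ => ∏ a ∈ s, f a ζ := by
  classical
  induction s using Finset.induction_on with
  | empty => simpa using memHardy_const ∞ 1
  | insert a s ha ih =>
    simp only [Finset.prod_insert ha]
    exact (hf a (Finset.mem_insert_self a s)).mul
      (ih fun b hb => hf b (Finset.mem_insert_of_mem hb))

theorem memHardy_det {ι : Type*} [Fintype ι] [DecidableEq ι] {M : UnitAddCircle → Matrix ι ι ℂ}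
    (hM : MemMatrixHardy ∞ M) : MemHardy ∞ fun ζ => (M ζ).det := by
  simp only [Matrix.det_apply']
  exact memHardy_sum _ fun σ _ => (memHardy_prod _ fun i _ => hM (σ i) i).const_mul _

/-- If `f` and its conjugate are both in `H²`, then `f` is constant. -/
theorem MemHardy.ae_eq_const {f : UnitAddCircle → ℂ} (hf : MemHardy 2 f)
    (hf' : MemConjHardy 2 f) : ∃ c : ℂ, ∀ᵐ ζ ∂haarAddCircle, f ζ = c := by
  refine ⟨fourierCoeff f 0, ?_⟩
  have hc : MemLp (fun _ : UnitAddCircle => fourierCoeff f 0) 2 haarAddCircle := memLp_const _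
  have h : hf.1.toLp f = hc.toLp _ := by
    apply (fourierBasis (T := 1)).repr.injective
    ext k
    rw [fourierBasis_repr, fourierBasis_repr, fourierCoeff_congr_ae hf.1.coeFn_toLp,
      fourierCoeff_congr_ae hc.coeFn_toLp]
    rcases lt_trichotomy k 0 with hk | rfl | hk
    · rw [hf.2 k hk, fourierCoeff_const _ hk.ne]
    · simp [fourierCoeff]
    · rw [fourierCoeff_const _ hk.ne']
      have := hf'.2 (-k) (by omega)
      rwa [fourierCoeff_star, neg_neg, star_eq_zero] at this
  exact (MemLp.toLp_eq_toLp_iff hf.1 hc).1 h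

/-- Pairing an outer function with a square-integrable row: a Fourier coefficient that vanishes on the
generators `ζ ^ j F(ζ) x` also vanishes on constant vectors. -/
theorem IsOuter.fourierCoeff_dotProduct_const {ι κ : Type*} [Fintype ι] [Fintype κ]
    {F : UnitAddCircle → Matrix ι κ ℂ} (hF : IsOuter F) {w : UnitAddCircle → ι → ℂ}
    (hw : ∀ i, MemLp (fun ζ => w ζ i) 2 haarAddCircle) (m : ℤ)
    (h : ∀ (j : ℕ) (x : κ → ℂ),
      fourierCoeff (fun ζ => w ζ ⬝ᵥ (fourier (j : ℤ) ζ • (F ζ *ᵥ x))) m = 0)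
    (c : ι → ℂ) : fourierCoeff (fun ζ => w ζ ⬝ᵥ c) m = 0 := by
  have hW : MemLp (fun ζ => WithLp.toLp 2 fun i => fourier m ζ * star (w ζ i)) 2
      (haarAddCircle : Measure UnitAddCircle) :=
    MemLp.of_eval_piLp fun i => (hw i).star.mul (p := ∞) (q := 2) (memLp_fourier m ∞)
  have hinner : ∀ (g : Lp (EuclideanSpace ℂ ι) 2 (haarAddCircle : Measure UnitAddCircle))
      (u : UnitAddCircle → ι → ℂ), (g =ᵐ[haarAddCircle] fun ζ => WithLp.toLp 2 (u ζ)) →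
      inner ℂ (hW.toLp _) g = fourierCoeff (fun ζ => w ζ ⬝ᵥ u ζ) m := by
    intro g u hu
    rw [L2.inner_def, fourierCoeff]
    apply integral_congr_ae
    filter_upwards [hu, hW.coeFn_toLp] with ζ h1 h2
    rw [h1, h2, EuclideanSpace.inner_toLp_toLp]
    simp only [dotProduct, Pi.star_apply, star_mul', smul_eq_mul, Finset.mul_sum,
      fourier_neg, RCLike.star_def]
    exact Finset.sum_congr rfl fun i _ => by rw [starRingEnd_self_apply]; ring
  have hc : MemLp (fun _ : UnitAddCircle => WithLp.toLp 2 c) 2 haarAddCircle := memLp_const _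
  have hmem : hc.toLp _ ∈ hardyTwo ι := fun k hk => by
    rw [fourierCoeff_congr_ae hc.coeFn_toLp, fourierCoeff_const _ hk.ne]
  rw [← hF.2] at hmem
  rw [← hinner _ (fun _ => c) hc.coeFn_toLp]
  apply Submodule.mem_orthogonal' _ _ |>.1 _ _ hmem
  rw [Submodule.orthogonal_closure, Submodule.mem_orthogonal']
  intro g hg
  induction hg using Submodule.span_induction with
  | mem g hg =>
    obtain ⟨j, x, hg⟩ := hg
    rw [hinner g _ hg, h j x]
  | zero => exact inner_zero_right _
  | add g g' _ _ h1 h2 => rw [inner_add_right, h1, h2, add_zero]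
  | smul a g _ h1 => rw [inner_smul_right, h1, mul_zero]

/-- The square matrix `(Υ  Θ̄)`, with columns indexed through `e`. -/
def blockMatrix {ι κ l : Type*} (e : ι ≃ κ ⊕ l) (Υ : Matrix ι κ ℂ) (Θ : Matrix ι l ℂ) :
    Matrix ι ι ℂ :=
  (Matrix.fromCols Υ (Θ.map star)).submatrix id e

theorem blockMatrix_swap {ι κ l : Type*} (e : ι ≃ κ ⊕ l) (Υ : Matrix ι κ ℂ) (Θ : Matrix ι l ℂ) :
    blockMatrix (e.trans (Equiv.sumComm κ l)) Θ Υ = (blockMatrix e Υ Θ).map star := by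
  ext i j
  rcases h : e j with a | a <;> simp [blockMatrix, h]

section Block

variable {ι κ l : Type*} [Fintype ι] [Fintype κ] [Fintype l] [DecidableEq κ]

theorem det_mul_eq_det_fromRows_mul [DecidableEq ι] [DecidableEq l]
    (e : ι ≃ κ ⊕ l) {Υ : Matrix ι κ ℂ} {Θ : Matrix ι l ℂ}
    (hU : blockMatrix e Υ Θ ∈ Matrix.unitaryGroup ι ℂ) (A : Matrix κ ι ℂ) :
    (A * Υ).det = ((Matrix.fromRows A Θᵀ).submatrix e id).det * (blockMatrix e Υ Θ).det := by
  have h1 : (Matrix.fromCols Υ (Θ.map star))ᴴ * Matrix.fromCols Υ (Θ.map star) = 1 := by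
    have h := congrArg (fun M => M.submatrix e.symm e.symm) (Matrix.mem_unitaryGroup_iff'.1 hU)
    rw [Matrix.submatrix_one_equiv] at h
    rw [← h, blockMatrix, Matrix.star_eq_conjTranspose, Matrix.conjTranspose_submatrix,
      ← Matrix.submatrix_mul _ _ e id e Function.bijective_id]
    simp
  rw [Matrix.conjTranspose_fromCols_eq_fromRows_conjTranspose, Matrix.fromRows_mul_fromCols,
    ← Matrix.fromBlocks_one, Matrix.fromBlocks_inj] at h1
  have h3 : (Θ.map star)ᴴ = Θᵀ := by
    ext i j
    simp
  obtain ⟨-, -, h4, h5⟩ := h1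
  rw [h3] at h4 h5
  rw [blockMatrix, ← Matrix.det_mul, ← Matrix.submatrix_mul _ _ e id e Function.bijective_id,
    Matrix.det_submatrix_equiv_self, Matrix.fromRows_mul_fromCols, h4, h5,
    Matrix.det_fromBlocks_zero₂₁, Matrix.det_one, mul_one]

theorem fourierCoeff_star_mul_det_replaceRows {Υ : UnitAddCircle → Matrix ι κ ℂ}
    (hΥ : MemMatrixHardy ∞ Υ) (hco : IsCoOuter Υ) {δ : UnitAddCircle → ℂ}
    (hδ : MemLp δ ∞ haarAddCircle)
    (h : ∀ A : UnitAddCircle → Matrix κ ι ℂ, MemMatrixHardy ∞ A →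
      MemHardy ∞ fun ζ => δ ζ * (A ζ * Υ ζ).det)
    (S : Finset κ) {A : UnitAddCircle → Matrix κ ι ℂ} (hA : MemMatrixHardy ∞ A) {m : ℤ}
    (hm : m < 0) :
    fourierCoeff (fun ζ => δ ζ *
      (Matrix.of fun c => if c ∈ S then Pi.single c (1 : ℂ) else (A ζ * Υ ζ) c).det) m = 0 := by
  induction S using Finset.induction_on generalizing A with
  | empty => exact (h A hA).2 m hm
  | insert c S hc ih =>
    set M : UnitAddCircle → Matrix κ κ ℂ := fun ζ =>
      Matrix.of fun c => if c ∈ S then Pi.single c (1 : ℂ) else (A ζ * Υ ζ) c with hM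
    have hMtop : ∀ i j, MemLp (fun ζ => M ζ i j) ∞ haarAddCircle := by
      intro i j
      by_cases hi : i ∈ S
      · simpa [hM, hi] using memLp_const _
      · simp only [hM, Matrix.of_apply, hi, if_false, Matrix.mul_apply]
        exact memLp_finsetSum _ fun a _ => memLp_mul_top (hA i a).1 (hΥ a j).1
    have hdet : ∀ ζ (x : κ → ℂ), (fun j => δ ζ * (M ζ)ᵀ.adjugate c j) ⬝ᵥ x =
        δ ζ * ((M ζ).updateRow c x).det := by
      intro ζ x
      rw [← Matrix.cramer_transpose_apply, Matrix.cramer_eq_adjugate_mulVec, Matrix.mulVec,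
        dotProduct, dotProduct, Finset.mul_sum]
      exact Finset.sum_congr rfl fun j _ => mul_assoc _ _ _
    have key := hco.fourierCoeff_dotProduct_const
      (w := fun ζ j => δ ζ * (M ζ)ᵀ.adjugate c j) (fun j => ?_) m ?_ (Pi.single c 1)
    · simp only [hdet] at key
      convert key using 5 with ζ
      ext a b
      by_cases ha : a = c
      · subst ha; simp
      · simp [hM, ha, Matrix.updateRow_ne]
    · refine memLp_two_of_top (memLp_mul_top hδ ?_)
      simp only [Matrix.adjugate_apply]
      refine memLp_det_top fun a b => ?_
      by_cases ha : a = j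
      · subst ha; simpa using memLp_const _
      · simpa [Matrix.updateRow_ne ha] using hMtop b a
    · intro k x
      have hB : MemMatrixHardy ∞ fun ζ => (A ζ).updateRow c (fourier (k : ℤ) ζ • x) := by
        intro a b
        by_cases ha : a = c
        · subst ha
          simpa [mul_comm] using (memHardy_fourier ∞ k).const_mul (x b)
        · simpa [Matrix.updateRow_ne ha] using hA a b
      rw [← ih hB]
      simp only [hdet]
      congr! 5 with ζ
      ext a b
      by_cases ha : a = c
      · subst ha
        simp [hc, Matrix.mul_apply, Matrix.mulVec, dotProduct, Finset.mul_sum]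
        exact Finset.sum_congr rfl fun i _ => by ring
      · by_cases haS : a ∈ S <;> simp [hM, ha, haS, Matrix.updateRow_ne, Matrix.mul_apply]

theorem memConjHardy_det_blockMatrix [DecidableEq ι] [DecidableEq l]
    (e : ι ≃ κ ⊕ l) {Υ : UnitAddCircle → Matrix ι κ ℂ}
    {Θ : UnitAddCircle → Matrix ι l ℂ} (hΥ : MemMatrixHardy ∞ Υ) (hΘ : MemMatrixHardy ∞ Θ)
    (hco : IsCoOuter Υ)
    (hU : ∀ᵐ ζ ∂haarAddCircle, blockMatrix e (Υ ζ) (Θ ζ) ∈ Matrix.unitaryGroup ι ℂ) :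
    MemConjHardy ∞ fun ζ => (blockMatrix e (Υ ζ) (Θ ζ)).det := by
  have hδ : MemLp (fun ζ => star (blockMatrix e (Υ ζ) (Θ ζ)).det) ∞ haarAddCircle := by
    refine MemLp.star (memLp_det_top fun i j => ?_)
    rcases h : e j with a | a
    · simpa [blockMatrix, h] using (hΥ i a).1
    · simp only [blockMatrix, Matrix.submatrix_apply, h, Matrix.fromCols_apply_inr]
      exact (hΘ i a).1.star
  refine ⟨hδ, fun m hm => ?_⟩
  have h := fourierCoeff_star_mul_det_replaceRows hΥ hco hδ (fun A hA => ?_) Finset.univ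
    (A := fun _ => 0) (fun _ _ => memHardy_const ∞ 0) hm
  · have h1 : (Matrix.of fun c : κ => (Pi.single c (1 : ℂ) : κ → ℂ)) = 1 := by
      ext a b
      simp [Matrix.one_apply, Pi.single_apply, eq_comm]
    simpa only [Finset.mem_univ, if_true, h1, Matrix.det_one, mul_one] using h
  · have hdet : MemHardy ∞ fun ζ => ((Matrix.fromRows (A ζ) (Θ ζ)ᵀ).submatrix e id).det := by
      refine memHardy_det fun i j => ?_
      rcases h : e i with a | a
      · simpa [h] using hA a j
      · simpa [h] using hΘ j a
    refine hdet.congr ?_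
    filter_upwards [hU] with ζ hζ
    rw [det_mul_eq_det_fromRows_mul e hζ, mul_left_comm]
    have := Matrix.det_of_mem_unitary hζ
    rw [(Unitary.mem_iff.1 this).1, mul_one]

/-- The determinant of a balanced matrix function is constant. -/
theorem exists_det_blockMatrix_eq_const [DecidableEq ι] [DecidableEq l]
    (e : ι ≃ κ ⊕ l) {Υ : UnitAddCircle → Matrix ι κ ℂ}
    {Θ : UnitAddCircle → Matrix ι l ℂ} (hΥ : MemMatrixHardy ∞ Υ) (hΘ : MemMatrixHardy ∞ Θ)
    (hcoΥ : IsCoOuter Υ) (hcoΘ : IsCoOuter Θ)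
    (hU : ∀ᵐ ζ ∂haarAddCircle, blockMatrix e (Υ ζ) (Θ ζ) ∈ Matrix.unitaryGroup ι ℂ) :
    ∃ c : ℂ, ∀ᵐ ζ ∂haarAddCircle, (blockMatrix e (Υ ζ) (Θ ζ)).det = c := by
  have hstar : ∀ M : Matrix ι ι ℂ, (M.map star).det = star M.det := fun M =>
    ((starRingEnd ℂ).map_det M).symm
  have h1 := memConjHardy_det_blockMatrix e hΥ hΘ hcoΥ hU
  have h2 := memConjHardy_det_blockMatrix (e.trans (Equiv.sumComm κ l)) hΘ hΥ hcoΘ (by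
    filter_upwards [hU] with ζ hζ
    rw [blockMatrix_swap]
    exact Matrix.map_star_mem_unitaryGroup_iff.2 hζ)
  simp only [blockMatrix_swap, hstar, MemConjHardy, star_star] at h2
  exact h2.two.ae_eq_const h1.two

end Block

theorem conjBlock_eq_blockMatrix {n r : ℕ} (hr : r ≤ n) (Υ : Matrix (Fin n) (Fin r) ℂ)
    (Θ : Matrix (Fin n) (Fin (n - r)) ℂ) :
    conjBlock Υ Θ = blockMatrix
      ((finCongr (Nat.add_sub_cancel' hr).symm).trans finSumFinEquiv.symm) Υ Θ := by
  ext i j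
  obtain ⟨s, rfl⟩ := ((finCongr (Nat.add_sub_cancel' hr).symm).trans
    finSumFinEquiv.symm).symm.surjective j
  rcases s with a | a <;> simp [conjBlock, blockMatrix]

/-- Jacobi's complementary minor formula for unitary matrices. -/
theorem det_submatrix_inl_of_mem_unitaryGroup {ι α β : Type*} [Fintype ι] [Fintype α] [Fintype β]
    [DecidableEq ι] [DecidableEq α] [DecidableEq β] {U : Matrix ι ι ℂ}
    (hU : U ∈ Matrix.unitaryGroup ι ℂ) (ρ σ : α ⊕ β ≃ ι) :
    (U.submatrix (ρ ∘ Sum.inl) (σ ∘ Sum.inl)).det =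
      Equiv.Perm.sign (σ.symm.trans ρ) * U.det *
        star (U.submatrix (ρ ∘ Sum.inr) (σ ∘ Sum.inr)).det := by
  have hdet : (U.submatrix ρ σ).det = Equiv.Perm.sign (σ.symm.trans ρ) * U.det := by
    rw [← Matrix.det_permute, ← Matrix.det_submatrix_equiv_self σ, Matrix.submatrix_submatrix]
    congr 2
    ext a
    simp
  have hW : U.submatrix ρ σ * (U.submatrix ρ σ)ᴴ = 1 := by
    rw [Matrix.conjTranspose_submatrix, Matrix.submatrix_mul_equiv,
      ← Matrix.star_eq_conjTranspose, Matrix.mem_unitaryGroup_iff.1 hU,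
      Matrix.submatrix_one_equiv]
  rw [← Matrix.fromBlocks_toBlocks (U.submatrix ρ σ), Matrix.fromBlocks_conjTranspose,
    Matrix.fromBlocks_multiply, ← Matrix.fromBlocks_one, Matrix.fromBlocks_inj] at hW
  obtain ⟨-, h2, -, h4⟩ := hW
  have h := congrArg Matrix.det (Matrix.fromBlocks_multiply (U.submatrix ρ σ).toBlocks₁₁
    (U.submatrix ρ σ).toBlocks₁₂ (U.submatrix ρ σ).toBlocks₂₁ (U.submatrix ρ σ).toBlocks₂₂
    1 (U.submatrix ρ σ).toBlocks₂₁ᴴ 0 (U.submatrix ρ σ).toBlocks₂₂ᴴ)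
  rw [h2, h4, Matrix.det_mul, Matrix.fromBlocks_toBlocks, Matrix.det_fromBlocks_zero₁₂,
    Matrix.det_fromBlocks_zero₂₁, Matrix.det_one, one_mul, Matrix.det_conjTranspose,
    hdet] at h
  simp only [Matrix.mul_zero, add_zero, Matrix.det_one, mul_one] at h
  exact h.symm

theorem exists_equiv_extending {n k : ℕ} {i : Fin k → Fin n} (hi : Function.Injective i) :
    ∃ ρ : Fin k ⊕ Fin (n - k) ≃ Fin n, ρ ∘ Sum.inl = i := by
  classical
  have hcard : Fintype.card ↥(Set.range i)ᶜ = n - k := by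
    rw [Fintype.card_compl_set, Set.card_range_of_injective hi, Fintype.card_fin, Fintype.card_fin]
  exact ⟨((Equiv.ofInjective i hi).sumCongr (Fintype.equivFinOfCardEq hcard).symm).trans
    (Equiv.Set.sumCompl (Set.range i)), by ext; simp⟩

theorem minor_eq_const_mul_star_det {n k : ℕ} {V : UnitAddCircle → Matrix (Fin n) (Fin n) ℂ}
    (hV : ∀ᵐ ζ ∂haarAddCircle, V ζ ∈ Matrix.unitaryGroup (Fin n) ℂ) {c : ℂ}
    (hc : ∀ᵐ ζ ∂haarAddCircle, (V ζ).det = c) (i j : Fin k ↪o Fin n) :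
    ∃ (d : ℂ) (i' j' : Fin (n - k) → Fin n), (∀ a, j' a ∉ Set.range j) ∧
      (fun ζ => d * star ((V ζ).submatrix i' j').det) =ᵐ[haarAddCircle] minor V i j := by
  obtain ⟨ρ, hρ⟩ := exists_equiv_extending i.injective
  obtain ⟨σ, hσ⟩ := exists_equiv_extending j.injective
  refine ⟨Equiv.Perm.sign (σ.symm.trans ρ) * c, ρ ∘ Sum.inr, σ ∘ Sum.inr, ?_, ?_⟩
  · rintro a ⟨b, hb⟩
    rw [← hσ] at hb
    exact Sum.inl_ne_inr (σ.injective hb)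
  · filter_upwards [hV, hc] with ζ h1 h2
    rw [minor, ← hρ, ← hσ, det_submatrix_inl_of_mem_unitaryGroup h1 ρ σ, h2]

theorem memHardy_minor {n k : ℕ} {V : UnitAddCircle → Matrix (Fin n) (Fin n) ℂ}
    (hV : ∀ᵐ ζ ∂haarAddCircle, V ζ ∈ Matrix.unitaryGroup (Fin n) ℂ) {c : ℂ}
    (hc : ∀ᵐ ζ ∂haarAddCircle, (V ζ).det = c) (i j : Fin k ↪o Fin n)
    (h : ∀ a, ∀ b ∉ Set.range j, MemConjHardy ∞ fun ζ => V ζ a b) :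
    MemHardy ∞ (minor V i j) := by
  obtain ⟨d, i', j', hj, hm⟩ := minor_eq_const_mul_star_det hV hc i j
  refine MemHardy.congr (MemHardy.const_mul ?_ d) hm
  simp only [← Matrix.det_conjTranspose]
  exact memHardy_det fun a b => h (i' b) (j' a) (hj a)

theorem memConjHardy_minor {n k : ℕ} {V : UnitAddCircle → Matrix (Fin n) (Fin n) ℂ}
    (hV : ∀ᵐ ζ ∂haarAddCircle, V ζ ∈ Matrix.unitaryGroup (Fin n) ℂ) {c : ℂ}
    (hc : ∀ᵐ ζ ∂haarAddCircle, (V ζ).det = c) (i j : Fin k ↪o Fin n)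
    (h : ∀ a, ∀ b ∉ Set.range j, MemHardy ∞ fun ζ => V ζ a b) :
    MemConjHardy ∞ (minor V i j) := by
  obtain ⟨d, i', j', hj, hm⟩ := minor_eq_const_mul_star_det hV hc i j
  have h1 : MemHardy ∞ fun ζ => ((V ζ).submatrix i' j').det :=
    memHardy_det fun a b => h (i' a) (j' b) (hj b)
  refine (h1.const_mul (star d)).congr ?_
  filter_upwards [hm] with ζ hζ
  rw [← hζ, star_mul', star_star]

theorem IsBalanced.le {n r : ℕ} {V : UnitAddCircle → Matrix (Fin n) (Fin n) ℂ}
    (hV : IsBalanced r V) : r ≤ n := by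
  rcases hV with ⟨-, h, -⟩ | ⟨rfl | rfl, -⟩ <;> omega

theorem IsBalanced.ae_mem_unitaryGroup {n r : ℕ} {V : UnitAddCircle → Matrix (Fin n) (Fin n) ℂ}
    (hV : IsBalanced r V) : ∀ᵐ ζ ∂haarAddCircle, V ζ ∈ Matrix.unitaryGroup (Fin n) ℂ := by
  rcases hV with ⟨-, -, h, -⟩ | ⟨-, U, hU, h⟩
  · exact h
  · filter_upwards [h] with ζ hζ
    rwa [hζ]

theorem IsBalanced.memHardy_apply {n r : ℕ} {V : UnitAddCircle → Matrix (Fin n) (Fin n) ℂ}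
    (hV : IsBalanced r V) (a : Fin n) {b : Fin n} (hb : (b : ℕ) < r) :
    MemHardy ∞ fun ζ => V ζ a b := by
  rcases hV with ⟨-, -, -, Υ, Θ, hΥ, -, -, -, h⟩ | ⟨-, U, -, h⟩
  · refine (hΥ.1 a ⟨b, hb⟩).congr ?_
    filter_upwards [h] with ζ hζ
    simp [hζ, conjBlock, hb]
  · refine (memHardy_const ∞ (U a b)).congr ?_
    filter_upwards [h] with ζ hζ
    rw [hζ]

theorem IsBalanced.memConjHardy_apply {n r : ℕ} {V : UnitAddCircle → Matrix (Fin n) (Fin n) ℂ}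
    (hV : IsBalanced r V) (a : Fin n) {b : Fin n} (hb : r ≤ (b : ℕ)) :
    MemConjHardy ∞ fun ζ => V ζ a b := by
  rcases hV with ⟨-, -, -, Υ, Θ, -, -, hΘ, -, h⟩ | ⟨-, U, -, h⟩
  · refine (hΘ.1 a ⟨(b : ℕ) - r, by omega⟩).congr ?_
    filter_upwards [h] with ζ hζ
    simp [hζ, conjBlock, hb.not_gt]
  · refine (memHardy_const ∞ (star (U a b))).congr ?_
    filter_upwards [h] with ζ hζ
    rw [hζ]

theorem IsBalanced.exists_det_eq_const {n r : ℕ} {V : UnitAddCircle → Matrix (Fin n) (Fin n) ℂ}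
    (hV : IsBalanced r V) : ∃ c : ℂ, ‖c‖ = 1 ∧ ∀ᵐ ζ ∂haarAddCircle, (V ζ).det = c := by
  have hU := hV.ae_mem_unitaryGroup
  have hc : ∃ c : ℂ, ∀ᵐ ζ ∂haarAddCircle, (V ζ).det = c := by
    rcases hV with ⟨-, hr, -, Υ, Θ, hΥ, hcoΥ, hΘ, hcoΘ, h⟩ | ⟨-, U, -, h⟩
    · simp only [conjBlock_eq_blockMatrix hr.le] at h
      obtain ⟨c, hc⟩ := exists_det_blockMatrix_eq_const _ hΥ.1 hΘ.1 hcoΥ hcoΘ (by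
        filter_upwards [hU, h] with ζ h1 h2
        exact h2 ▸ h1)
      refine ⟨c, ?_⟩
      filter_upwards [hc, h] with ζ h1 h2
      rw [h2, h1]
    · refine ⟨U.det, ?_⟩
      filter_upwards [h] with ζ hζ
      rw [hζ]
  obtain ⟨c, hc⟩ := hc
  obtain ⟨ζ, h1, h2⟩ := (hU.and hc).exists
  refine ⟨c, ?_, hc⟩
  rw [← h2]
  exact CStarRing.norm_of_mem_unitary (Matrix.det_of_mem_unitary h1)

theorem OnFirstColumns.le_of_notMem_range {n k r : ℕ} {j : Fin k ↪o Fin n}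
    (hj : OnFirstColumns r j) {b : Fin n} (hb : b ∉ Set.range j) : r ≤ (b : ℕ) := by
  by_contra! h
  exact hb ⟨⟨b, h.trans_le hj.1⟩, Fin.ext (hj.2 ⟨b, h.trans_le hj.1⟩ h)⟩

theorem OnLastColumns.lt_of_notMem_range {n k r : ℕ} {j : Fin k ↪o Fin n}
    (hj : OnLastColumns (n - r) j) {b : Fin n} (hb : b ∉ Set.range j) : (b : ℕ) < r := by
  by_contra! h
  have h1 := hj.1
  have h2 := b.isLt
  refine hb ⟨⟨(b : ℕ) + k - n, by omega⟩, Fin.ext ?_⟩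
  have h3 := hj.2 ⟨(b : ℕ) + k - n, by omega⟩ (by simp only; omega)
  simp only at h3
  omega

end BalancedMatrix

theorem theorem3p2 {n r : ℕ} (V : UnitAddCircle → Matrix (Fin n) (Fin n) ℂ)
    (hV : BalancedMatrix.IsBalanced r V) :
    (∀ (k : ℕ) (i j : Fin k ↪o Fin n), BalancedMatrix.OnFirstColumns r j →
      BalancedMatrix.MemHardy ∞ (BalancedMatrix.minor V i j)) ∧
    (∀ (k : ℕ) (i j : Fin k ↪o Fin n), BalancedMatrix.OnLastColumns (n - r) j →
      BalancedMatrix.MemConjHardy ∞ (BalancedMatrix.minor V i j)) ∧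
    ∃ c : ℂ, ‖c‖ = 1 ∧ ∀ᵐ ζ ∂AddCircle.haarAddCircle, (V ζ).det = c := by
  obtain ⟨c, hc1, hc⟩ := hV.exists_det_eq_const
  exact ⟨fun k i j hj => BalancedMatrix.memHardy_minor hV.ae_mem_unitaryGroup hc i j
      fun a b hb => hV.memConjHardy_apply a (hj.le_of_notMem_range hb),
    fun k i j hj => BalancedMatrix.memConjHardy_minor hV.ae_mem_unitaryGroup hc i j
      fun a b hb => hV.memHardy_apply a (hj.lt_of_notMem_range hb), c, hc1, hc⟩
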